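/- Let $\mathcal M$ be a matroid of rank $k$ on a finite ground set $\Omega$ with $n$ elements, and let $f:2^\Omega\to\mathbb R_{\ge 0}$ be a submodular, not necessarily monotone function with $f(\emptyset)=0$. For $S\subseteq\Omega$ and $e\in\Omega$ write $f_S(e)=f(S\cup\{e\})-f(S)$, and let $\mathrm{OPT}=\max\{f(I): I \text{ independent in }\mathcal M\}$. Assume that $f(\{e\})\le\mathrm{OPT}$ for every $e\in\Omega$ (this is automatic if $\mathcal M$ has no loops) and that, if the highest value of $f(\{e\})$ is attained by exactly one element, then the second-highest value is also attained by exactly one element (for example, all values $f(\{e\})$ are distinct, or the highest value is attained more than once). The elements of $\Omega$ arrive one at a time in uniformly random order; $n$ and $k$ are known in advance, and $f$ and independence can be queried only on sets of elements that have already arrived. Consider the following algorithm. * Before the stream starts, choose $i\in\{0,1,\dots,2+\lceil\log_2(2k)\rceil\}$ and $j\in\{1,2\}$ uniformly and independently at random (for $k=0$, $i\in\{0,1,2\}$). * Observe the first $\lfloor n/2\rfloor$ elements without selecting any. Let $W$ be the highest value $f(\{e\})$ of an observed element ($W=0$ if none was observed). * Set $S_1=S_2=\emptyset$ and process the remaining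 elements in order of arrival: when $e$ arrives, add it to $S_1$ if $f_{S_1}(e)\ge W/2^i$ and $S_1\cup\{e\}$ is independent; otherwise add it to $S_2$ if $f_{S_2}(e)\ge W/2^i$ and $S_2\cup\{e\}$ is independent; otherwise discard it. The selected set is $S_j$. Then this is a valid algorithm for the secretary setting (each element is irrevocably selected or rejected on arrival, using only information about elements that have arrived), its output is always independent, and it is an $O(\log k)$-approximation: there is an absolute constant $C>0$, the same for all $\Omega,\mathcal M,k,f$, such that $$\mathrm{OPT}\;\le\; C\,(1+\log k)\;\mathbb E[f(S_j)],$$ where the expectation is over the arrival order, $i$ and $j$, and $\log 0$ is read as $0$ when $k=0$. -/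

import Mathlib

open scoped BigOperators

namespace SubmodularSecretary

/-- Submodularity of a set function on a finite ground set. -/
def IsSubmodular {Ω : Type*} [DecidableEq Ω] (f : Finset Ω → ℝ) : Prop :=
  ∀ S T : Finset Ω, f (S ∪ T) + f (S ∩ T) ≤ f S + f T

/-- The marginal value `f_S(e) = f(S + e) - f(S)`. -/
def marginal {Ω : Type*} [DecidableEq Ω] (f : Finset Ω → ℝ) (S : Finset Ω) (e : Ω) : ℝ :=
  f (insert e S) - f S

open Classical in
/-- One step of the two-set threshold algorithm with threshold `θ` and independence oracle `Ind`:
the arriving element goes to the first set if its marginal value there is at least `θ` and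
independence is kept, otherwise to the second set under the same conditions, otherwise it is
discarded. -/
noncomputable def thresholdStep {Ω : Type*} [DecidableEq Ω] (f : Finset Ω → ℝ)
    (Ind : Finset Ω → Prop) (θ : ℝ) (S : Finset Ω × Finset Ω) (e : Ω) : Finset Ω × Finset Ω :=
  if θ ≤ marginal f S.1 e ∧ Ind (insert e S.1) then (insert e S.1, S.2)
  else if θ ≤ marginal f S.2 e ∧ Ind (insert e S.2) then (S.1, insert e S.2)
  else S

/-- The pair `(S₁, S₂)` built by the two-set threshold algorithm on the stream `l`. -/
noncomputable def thresholdSets {Ω : Type*} [DecidableEq Ω] (f : Finset Ω → ℝ)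
    (Ind : Finset Ω → Prop) (θ : ℝ) (l : List Ω) : Finset Ω × Finset Ω :=
  l.foldl (thresholdStep f Ind θ) (∅, ∅)

/-- The highest value of a single element of the list `l` (and `0` for the empty list). -/
noncomputable def bestSingle {Ω : Type*} (f : Finset Ω → ℝ) (l : List Ω) : ℝ :=
  l.foldr (fun e w => max (f {e}) w) 0

/-- The set selected by the secretary algorithm, with random choices `i` and `b`, after the
elements of `l` have arrived, where `n` is the total number of elements. The first `⌊n/2⌋` arrivals
are the sample, and `W` is the best value of a single sampled element. The threshold algorithm with
threshold `W / 2 ^ i` is run on the later arrivals, and `b` says which of its two sets is kept. -/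
noncomputable def secretarySelect {Ω : Type*} [DecidableEq Ω] (n i : ℕ) (b : Bool)
    (f : Finset Ω → ℝ) (Ind : Finset Ω → Prop) (l : List Ω) : Finset Ω :=
  let W := bestSingle f (l.take (n / 2))
  let S := thresholdSets f Ind (W / 2 ^ i) (l.drop (n / 2))
  if b then S.1 else S.2

/-- A selection procedure is online: each arriving element is irrevocably selected or rejected when
it arrives, and what has been selected so far depends only on the values and the independence of
sets of elements that have already arrived. -/
def IsOnline {Ω : Type*} [DecidableEq Ω]
    (A : (Finset Ω → ℝ) → (Finset Ω → Prop) → List Ω → Finset Ω) : Prop :=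
  (∀ f Ind, A f Ind [] = ∅) ∧
  (∀ f Ind l e, A f Ind (l ++ [e]) = A f Ind l ∨ A f Ind (l ++ [e]) = insert e (A f Ind l)) ∧
  (∀ f g Ind Jnd l, (∀ S : Finset Ω, S ⊆ l.toFinset → f S = g S ∧ (Ind S ↔ Jnd S)) →
    A f Ind l = A g Jnd l)

/-- The independence oracle of a matroid. -/
def indepOracle {Ω : Type*} (M : Matroid Ω) (S : Finset Ω) : Prop := M.Indep (S : Set Ω)

/-- The number of values of the random exponent `i ∈ {0, 1, …, 2 + log₂ (2k)}` (with the logarithm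
rounded up). -/
def numThresholds (k : ℕ) : ℕ := 3 + Nat.clog 2 (2 * k)

/-- The set output by the secretary algorithm when the elements arrive in the order `σ`. -/
noncomputable def secretaryOutput {Ω : Type*} [Fintype Ω] [DecidableEq Ω] (f : Finset Ω → ℝ)
    (M : Matroid Ω) (σ : Fin (Fintype.card Ω) ≃ Ω) (i : ℕ) (b : Bool) : Finset Ω :=
  secretarySelect (Fintype.card Ω) i b f (indepOracle M) (List.ofFn σ)

/-- The expected value of the output, over a uniformly random arrival order, a uniformly random
exponent, and a fair coin that chooses one of the two sets (all independent). -/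
noncomputable def expectedValue {Ω : Type*} [Fintype Ω] [DecidableEq Ω] (f : Finset Ω → ℝ)
    (M : Matroid Ω) (k : ℕ) : ℝ :=
  𝔼 σ : Fin (Fintype.card Ω) ≃ Ω, 𝔼 i ∈ Finset.range (numThresholds k), 𝔼 b : Bool,
    f (secretaryOutput f M σ i b)

/-- If exactly one element `e₁` has the highest single-element value, then exactly one element has
the second-highest value. This holds in particular if all single-element values are distinct, and
also if the highest value is attained more than once. -/
def NoRunnerUpTie {Ω : Type*} (f : Finset Ω → ℝ) : Prop :=
  ∀ e₁ e₂ e₃ : Ω, f {e₂} < f {e₁} → (∀ e, e ≠ e₁ → f {e} ≤ f {e₂}) → f {e₃} = f {e₂} → e₃ = e₂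

end SubmodularSecretary

namespace SubmodularSecretary

variable {Ω : Type*}

/-! ### The best sampled value -/

/-! Fix a threshold θ and an independent set A of arriving elements. At most |S₁| + |S₂| elements of
A lie in, or are blocked by independence from, S₁ or S₂; the others form a set B whose marginals to
both sets are at most θ. As S₁ and S₂ are disjoint, submodularity and nonnegativity give f(B) ≤ f(S₁
∪ B) + f(S₂ ∪ B), which replaces monotonicity. The blocked part D satisfies θ|D| ≤ f(S₁) + f(S₂), so
it can be charged at threshold 2θ, and so on up to W (`exists_blocked_subset`, `le_sum_totalValue`).
Hence the sum over all thresholds pays for f(A), up to a small multiple of W.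

Let e₁ have the highest single value and let O be optimal. If e₁ ∉ O or f(O) ≥ 2f({e₁}), sampling e₁
calibrates W, and enough of O arrives later on average (`expect_spread`). Otherwise e₁ alone is
worth more than half of f(O), and is independent; when the runner-up is sampled and e₁ arrives
later, exponent 0 secures f({e₁}) (`expect_single`). Both averages come from pairing each order with
its near-reversal (`le_expect_of_pairing`). Choosing the exponent and the set at random costs a
factor 2·`numThresholds k`, which is O(1 + log k). -/

theorem le_bestSingle (f : Finset Ω → ℝ) {l : List Ω} {e : Ω} (he : e ∈ l) :
    f {e} ≤ bestSingle f l := by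
  induction l with
  | nil => simp at he
  | cons a l ih =>
    rcases List.mem_cons.1 he with rfl | he
    · exact le_max_left _ _
    · exact (ih he).trans (le_max_right _ _)

theorem bestSingle_le (f : Finset Ω → ℝ) {l : List Ω} {c : ℝ} (hc : 0 ≤ c)
    (h : ∀ e ∈ l, f {e} ≤ c) : bestSingle f l ≤ c := by
  induction l with
  | nil => exact hc
  | cons a l ih =>
    exact max_le (h a List.mem_cons_self) (ih fun e he => h e (List.mem_cons_of_mem a he))

theorem bestSingle_congr {f g : Finset Ω → ℝ} {l : List Ω} (h : ∀ e ∈ l, f {e} = g {e}) :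
    bestSingle f l = bestSingle g l := by
  induction l with
  | nil => rfl
  | cons a l ih =>
    have h1 := ih fun e he => h e (List.mem_cons_of_mem a he)
    change max (f {a}) (bestSingle f l) = max (g {a}) (bestSingle g l)
    rw [h1, h a List.mem_cons_self]

/-! ### Positions in the arrival order -/

section Positions

variable [Fintype Ω]

/-- The elements that arrive after the sample. -/
def arriving (σ : Fin (Fintype.card Ω) ≃ Ω) : Finset Ω :=
  Finset.univ.filter fun x => Fintype.card Ω / 2 ≤ (σ.symm x).val

theorem mem_arriving {σ : Fin (Fintype.card Ω) ≃ Ω} {x : Ω} :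
    x ∈ arriving σ ↔ Fintype.card Ω / 2 ≤ (σ.symm x).val := by
  simp [arriving]

theorem mem_take_ofFn {σ : Fin (Fintype.card Ω) ≃ Ω} {x : Ω}
    (h : (σ.symm x).val < Fintype.card Ω / 2) :
    x ∈ (List.ofFn σ).take (Fintype.card Ω / 2) := by
  rw [List.mem_take_iff_getElem]
  exact ⟨(σ.symm x).val, by simp [h], by simp⟩

theorem mem_drop_ofFn {σ : Fin (Fintype.card Ω) ≃ Ω} {x : Ω} :
    x ∈ (List.ofFn σ).drop (Fintype.card Ω / 2) ↔ Fintype.card Ω / 2 ≤ (σ.symm x).val := by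
  rw [List.mem_drop_iff_getElem]
  constructor
  · rintro ⟨i, hi, rfl⟩
    simp
  · intro h
    have h2 := (σ.symm x).isLt
    refine ⟨(σ.symm x).val - Fintype.card Ω / 2, by simp; omega, ?_⟩
    simp [Nat.add_sub_cancel' h]

theorem nodup_drop_ofFn (σ : Fin (Fintype.card Ω) ≃ Ω) (m : ℕ) :
    ((List.ofFn σ).drop m).Nodup :=
  (List.nodup_ofFn.2 σ.injective).sublist (List.drop_sublist _ _)

/-- Reversing time, but keeping position `p` fixed. -/
def revFixing {n : ℕ} (p : Fin n) : Equiv.Perm (Fin n) := (Equiv.swap p p.rev).trans Fin.revPerm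

theorem revFixing_self {n : ℕ} (p : Fin n) : revFixing p p = p := by
  simp [revFixing]

theorem le_revFixing {n : ℕ} {p a : Fin n} (hp : p.val < n / 2) (ha : a.val < n / 2)
    (h : a ≠ p) : n / 2 ≤ (revFixing p a).val := by
  have h1 : a ≠ p.rev := by
    intro h
    rw [h, Fin.val_rev] at ha
    omega
  simp only [revFixing, Equiv.trans_apply, Equiv.swap_apply_of_ne_of_ne h h1, Fin.revPerm_apply,
    Fin.val_rev]
  omega

/-- The element at a sampled position p stays sampled in both orders, while every other element
arrives after the sample in at least one of them. This makes it possible to condition on a sampled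
element. -/
theorem arriving_revFixing {σ : Fin (Fintype.card Ω) ≃ Ω} {p : Fin (Fintype.card Ω)}
    (hp : p.val < Fintype.card Ω / 2) {x : Ω} (hx : x ≠ σ p) :
    x ∈ arriving σ ∨ x ∈ arriving ((revFixing p).symm.trans σ) := by
  rw [mem_arriving, mem_arriving]
  by_contra! h
  have h1 : σ.symm x ≠ p := fun h' => hx ((Equiv.symm_apply_eq σ).1 h')
  have := le_revFixing hp h.1 h1
  simp at h
  omega

end Positions
variable [DecidableEq Ω]

/-! ### Submodular functions -/

theorem IsSubmodular.marginal_anti {f : Finset Ω → ℝ} (hf : IsSubmodular f) {S T : Finset Ω}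
    (hST : S ⊆ T) {e : Ω} (he : e ∉ T) : marginal f T e ≤ marginal f S e := by
  have h := hf (insert e S) T
  have h1 : insert e S ∪ T = insert e T := by
    rw [Finset.insert_union, Finset.union_eq_right.2 hST]
  have h2 : insert e S ∩ T = S := by
    rw [Finset.insert_inter_of_notMem he, Finset.inter_eq_left.2 hST]
  rw [h1, h2] at h
  unfold marginal
  linarith

theorem IsSubmodular.union_le {f : Finset Ω → ℝ} (hf : IsSubmodular f) {θ : ℝ} {S : Finset Ω}
    (B : Finset Ω) (hB : ∀ e ∈ B, e ∉ S ∧ marginal f S e ≤ θ) :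
    f (S ∪ B) ≤ f S + θ * B.card := by
  induction B using Finset.induction_on with
  | empty => simp
  | insert e B he ih =>
    have ih' := ih fun x hx => hB x (Finset.mem_insert_of_mem hx)
    obtain ⟨h1, h2⟩ := hB e (Finset.mem_insert_self e B)
    have h3 : marginal f (S ∪ B) e ≤ marginal f S e :=
      hf.marginal_anti Finset.subset_union_left (by simp [h1, he])
    rw [Finset.union_insert, Finset.card_insert_of_notMem he]
    unfold marginal at h2 h3
    push_cast
    linarith

theorem IsSubmodular.le_mul_card {f : Finset Ω → ℝ} (hf : IsSubmodular f) (h0 : f ∅ = 0)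
    {w : ℝ} (A : Finset Ω) (hA : ∀ e ∈ A, f {e} ≤ w) : f A ≤ w * A.card := by
  have h := hf.union_le (S := ∅) (θ := w) A fun e he => ⟨by simp, by simpa [marginal, h0] using hA e he⟩
  simpa [h0] using h

/-! ### The two-set threshold algorithm -/

theorem thresholdStep_cases (f : Finset Ω → ℝ) (Ind : Finset Ω → Prop) (θ : ℝ)
    (S : Finset Ω × Finset Ω) (e : Ω) :
    (θ ≤ marginal f S.1 e ∧ Ind (insert e S.1) ∧
        thresholdStep f Ind θ S e = (insert e S.1, S.2)) ∨
      (¬(θ ≤ marginal f S.1 e ∧ Ind (insert e S.1)) ∧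
        θ ≤ marginal f S.2 e ∧ Ind (insert e S.2) ∧
        thresholdStep f Ind θ S e = (S.1, insert e S.2)) ∨
      (¬(θ ≤ marginal f S.1 e ∧ Ind (insert e S.1)) ∧
        ¬(θ ≤ marginal f S.2 e ∧ Ind (insert e S.2)) ∧ thresholdStep f Ind θ S e = S) := by
  unfold thresholdStep
  split_ifs with h1 h2
  · exact Or.inl ⟨h1.1, h1.2, rfl⟩
  · exact Or.inr (Or.inl ⟨h1, h2.1, h2.2, rfl⟩)
  · exact Or.inr (Or.inr ⟨h1, h2, rfl⟩)

/-- A property of sets that survives the accepted insertions holds for both sets built by the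
threshold algorithm. -/
theorem foldl_thresholdStep_induct {f : Finset Ω → ℝ} {Ind : Finset Ω → Prop} {θ : ℝ}
    {P : Finset Ω → Prop} (l : List Ω)
    (hP : ∀ S, P S → ∀ e ∈ l, θ ≤ marginal f S e → Ind (insert e S) → P (insert e S))
    (S : Finset Ω × Finset Ω) (h1 : P S.1) (h2 : P S.2) :
    P (l.foldl (thresholdStep f Ind θ) S).1 ∧ P (l.foldl (thresholdStep f Ind θ) S).2 := by
  induction l generalizing S with
  | nil => exact ⟨h1, h2⟩
  | cons a l ih =>
    have hP' := fun S hS e he => hP S hS e (List.mem_cons_of_mem a he)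
    rw [List.foldl_cons]
    rcases thresholdStep_cases f Ind θ S a with ⟨ha, hb, hc⟩ | ⟨-, ha, hb, hc⟩ | ⟨-, -, hc⟩ <;>
      rw [hc]
    · exact ih hP' _ (hP _ h1 a List.mem_cons_self ha hb) h2
    · exact ih hP' _ h1 (hP _ h2 a List.mem_cons_self ha hb)
    · exact ih hP' _ h1 h2

theorem thresholdSets_induct {f : Finset Ω → ℝ} {Ind : Finset Ω → Prop} {θ : ℝ}
    {P : Finset Ω → Prop} (l : List Ω) (h0 : P ∅)
    (hP : ∀ S, P S → ∀ e ∈ l, θ ≤ marginal f S e → Ind (insert e S) → P (insert e S)) :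
    P (thresholdSets f Ind θ l).1 ∧ P (thresholdSets f Ind θ l).2 :=
  foldl_thresholdStep_induct l hP _ h0 h0

theorem subset_foldl_thresholdStep (f : Finset Ω → ℝ) (Ind : Finset Ω → Prop) (θ : ℝ)
    (l : List Ω) (S : Finset Ω × Finset Ω) :
    S.1 ⊆ (l.foldl (thresholdStep f Ind θ) S).1 ∧ S.2 ⊆ (l.foldl (thresholdStep f Ind θ) S).2 := by
  induction l generalizing S with
  | nil => exact ⟨subset_rfl, subset_rfl⟩
  | cons a l ih =>
    rw [List.foldl_cons]
    have h := ih (thresholdStep f Ind θ S a)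
    rcases thresholdStep_cases f Ind θ S a with ⟨-, -, hc⟩ | ⟨-, -, -, hc⟩ | ⟨-, -, hc⟩ <;>
      rw [hc] at h ⊢
    · exact ⟨(Finset.subset_insert _ _).trans h.1, h.2⟩
    · exact ⟨h.1, (Finset.subset_insert _ _).trans h.2⟩
    · exact h

theorem thresholdSets_subset (f : Finset Ω → ℝ) (Ind : Finset Ω → Prop) (θ : ℝ) (l : List Ω) :
    (thresholdSets f Ind θ l).1 ⊆ l.toFinset ∧ (thresholdSets f Ind θ l).2 ⊆ l.toFinset :=
  thresholdSets_induct (P := fun S => S ⊆ l.toFinset) l (Finset.empty_subset _)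
    fun _ hS _ he _ _ => Finset.insert_subset (List.mem_toFinset.2 he) hS

theorem thresholdSets_append (f : Finset Ω → ℝ) (Ind : Finset Ω → Prop) (θ : ℝ) (l : List Ω)
    (e : Ω) : thresholdSets f Ind θ (l ++ [e]) =
      thresholdStep f Ind θ (thresholdSets f Ind θ l) e := by
  simp [thresholdSets]

theorem thresholdSets_indep {f : Finset Ω → ℝ} (M : Matroid Ω) {θ : ℝ} (l : List Ω) :
    M.Indep ((thresholdSets f (indepOracle M) θ l).1 : Set Ω) ∧
      M.Indep ((thresholdSets f (indepOracle M) θ l).2 : Set Ω) :=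
  thresholdSets_induct (P := fun S => M.Indep (S : Set Ω)) l (by simp)
    fun _ _ _ _ _ h => h

theorem thresholdSets_card_le {f : Finset Ω → ℝ} (h0 : f ∅ = 0) {Ind : Finset Ω → Prop} {θ : ℝ}
    (l : List Ω) :
    θ * (thresholdSets f Ind θ l).1.card ≤ f (thresholdSets f Ind θ l).1 ∧
      θ * (thresholdSets f Ind θ l).2.card ≤ f (thresholdSets f Ind θ l).2 := by
  refine thresholdSets_induct (P := fun S => θ * S.card ≤ f S) l (by simp [h0]) ?_
  intro S hS e _ h _
  by_cases he : e ∈ S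
  · rwa [Finset.insert_eq_of_mem he]
  · rw [Finset.card_insert_of_notMem he]
    unfold marginal at h
    push_cast
    linarith

theorem thresholdSets_single_ge {f : Finset Ω → ℝ} (hf : IsSubmodular f) (h0 : f ∅ = 0)
    {Ind : Finset Ω → Prop} {θ : ℝ} (l : List Ω) :
    ∀ e ∈ (thresholdSets f Ind θ l).1, θ ≤ f {e} := by
  refine (thresholdSets_induct (P := fun S => ∀ e ∈ S, θ ≤ f {e}) l (by simp) ?_).1
  intro S hS e _ h _ x hx
  rcases Finset.mem_insert.1 hx with rfl | hx
  · by_cases hxS : x ∈ S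
    · exact hS x hxS
    · have := hf.marginal_anti (Finset.empty_subset S) hxS
      simp only [marginal, insert_empty_eq, h0, sub_zero] at this h
      linarith
  · exact hS x hx

theorem thresholdSets_disjoint {f : Finset Ω → ℝ} {Ind : Finset Ω → Prop} {θ : ℝ} (l : List Ω)
    (hl : l.Nodup) :
    Disjoint (thresholdSets f Ind θ l).1 (thresholdSets f Ind θ l).2 := by
  induction l using List.reverseRecOn with
  | nil => simp [thresholdSets]
  | append_singleton l e ih =>
    have hl' := List.nodup_append.1 hl
    have he : e ∉ l.toFinset := fun h => hl'.2.2 e (List.mem_toFinset.1 h) e (by simp) rfl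
    have hd := ih hl'.1
    have hs := thresholdSets_subset f Ind θ l
    rw [thresholdSets_append]
    rcases thresholdStep_cases f Ind θ (thresholdSets f Ind θ l) e with
      ⟨-, -, hc⟩ | ⟨-, -, -, hc⟩ | ⟨-, -, hc⟩ <;> rw [hc]
    · exact Finset.disjoint_insert_left.2 ⟨fun h => he (hs.2 h), hd⟩
    · exact Finset.disjoint_insert_right.2 ⟨fun h => he (hs.1 h), hd⟩
    · exact hd

theorem rejected_of_subset {f : Finset Ω → ℝ} (hf : IsSubmodular f) {M : Matroid Ω} {θ : ℝ}
    {S T : Finset Ω} (hST : S ⊆ T) {e : Ω} (he : e ∉ T)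
    (h : ¬(θ ≤ marginal f S e ∧ indepOracle M (insert e S))) :
    ¬(θ ≤ marginal f T e ∧ indepOracle M (insert e T)) := fun h' =>
  h ⟨h'.1.trans (hf.marginal_anti hST he),
    Matroid.Indep.subset h'.2 (Finset.coe_subset.2 (Finset.insert_subset_insert e hST))⟩

/-- A rejection on arrival remains justified against the final sets, since marginals only shrink and
dependence persists as the sets grow. An element of S₂ was also rejected by S₁. -/
theorem thresholdSets_rejected {f : Finset Ω → ℝ} (hf : IsSubmodular f) (M : Matroid Ω) {θ : ℝ}
    (l : List Ω) {e : Ω} (he : e ∈ l) {S : Finset Ω × Finset Ω}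
    (hS : thresholdSets f (indepOracle M) θ l = S) (h1 : e ∉ S.1) :
    ¬(θ ≤ marginal f S.1 e ∧ indepOracle M (insert e S.1)) ∧
      (e ∉ S.2 → ¬(θ ≤ marginal f S.2 e ∧ indepOracle M (insert e S.2))) := by
  obtain ⟨l₁, l₂, rfl⟩ := List.append_of_mem he
  unfold thresholdSets at hS
  rw [List.foldl_append, List.foldl_cons] at hS
  set R := l₁.foldl (thresholdStep f (indepOracle M) θ) (∅, ∅)
  have hsub := subset_foldl_thresholdStep f (indepOracle M) θ l₂
    (thresholdStep f (indepOracle M) θ R e)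
  rw [hS] at hsub
  rcases thresholdStep_cases f (indepOracle M) θ R e with
      ⟨-, -, hc⟩ | ⟨ha, -, -, hc⟩ | ⟨ha, hb, hc⟩ <;> rw [hc] at hsub
  · exact absurd (hsub.1 (Finset.mem_insert_self _ _)) h1
  · exact ⟨rejected_of_subset hf hsub.1 h1 ha,
      fun h2 => absurd (hsub.2 (Finset.mem_insert_self _ _)) h2⟩
  · exact ⟨rejected_of_subset hf hsub.1 h1 ha, fun h2 => rejected_of_subset hf hsub.2 h2 hb⟩

-- The blocked part of A is itself independent; were it larger than S, matroid augmentation would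
-- extend S by a blocked element outside S.
open Classical in
theorem card_blocked_le {M : Matroid Ω} {A S : Finset Ω} (hA : M.Indep (A : Set Ω))
    (hS : M.Indep (S : Set Ω)) :
    (A.filter fun e => e ∈ S ∨ ¬ indepOracle M (insert e S)).card ≤ S.card := by
  set D := A.filter fun e => e ∈ S ∨ ¬ indepOracle M (insert e S)
  by_contra! hlt
  have hDi : M.Indep (D : Set Ω) := hA.subset (Finset.coe_subset.2 (Finset.filter_subset _ _))
  obtain ⟨e, he, hi⟩ := hS.augment hDi (by
    rw [Set.encard_coe_eq_coe_finsetCard, Set.encard_coe_eq_coe_finsetCard]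
    exact_mod_cast hlt)
  have he1 : e ∈ D := by simpa using he.1
  have he2 : e ∉ S := by simpa using he.2
  rcases (Finset.mem_filter.1 he1).2 with h | h
  · exact he2 h
  · exact h (by unfold indepOracle; rwa [Finset.coe_insert])

/-- The total value of the two sets built by the threshold algorithm. -/
noncomputable def totalValue (f : Finset Ω → ℝ) (M : Matroid Ω) (θ : ℝ) (l : List Ω) : ℝ :=
  f (thresholdSets f (indepOracle M) θ l).1 + f (thresholdSets f (indepOracle M) θ l).2

theorem totalValue_nonneg {f : Finset Ω → ℝ} (hpos : ∀ S, 0 ≤ f S) (M : Matroid Ω) (θ : ℝ)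
    (l : List Ω) : 0 ≤ totalValue f M θ l :=
  add_nonneg (hpos _) (hpos _)

open Classical in
theorem exists_blocked_subset {f : Finset Ω → ℝ} (hf : IsSubmodular f) (hpos : ∀ S, 0 ≤ f S)
    (h0 : f ∅ = 0) (M : Matroid Ω) {θ : ℝ} (hθ : 0 ≤ θ) {l : List Ω} (hl : l.Nodup)
    {A : Finset Ω} (hA : M.Indep (A : Set Ω)) (hAl : ∀ e ∈ A, e ∈ l) :
    ∃ D ⊆ A, θ * D.card ≤ totalValue f M θ l ∧
      f A ≤ f D + totalValue f M θ l + 2 * θ * A.card := by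
  set S := thresholdSets f (indepOracle M) θ l with hS
  have hind : M.Indep (S.1 : Set Ω) ∧ M.Indep (S.2 : Set Ω) := thresholdSets_indep M l
  have hcard : θ * S.1.card ≤ f S.1 ∧ θ * S.2.card ≤ f S.2 := thresholdSets_card_le h0 l
  have hdisj : Disjoint S.1 S.2 := thresholdSets_disjoint l hl
  have htot : totalValue f M θ l = f S.1 + f S.2 := rfl
  set p₁ : Ω → Prop := fun e => e ∈ S.1 ∨ ¬ indepOracle M (insert e S.1) with hp₁
  set p₂ : Ω → Prop := fun e => e ∈ S.2 ∨ ¬ indepOracle M (insert e S.2) with hp₂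
  refine ⟨A.filter fun e => p₁ e ∨ p₂ e, Finset.filter_subset _ _, ?_, ?_⟩
  · have h1 : (A.filter fun e => p₁ e ∨ p₂ e).card ≤ S.1.card + S.2.card := by
      rw [Finset.filter_or]
      exact (Finset.card_union_le _ _).trans
        (add_le_add (card_blocked_le hA hind.1) (card_blocked_le hA hind.2))
    have h2 : ((A.filter fun e => p₁ e ∨ p₂ e).card : ℝ) ≤ S.1.card + S.2.card := by exact_mod_cast h1
    rw [htot]
    nlinarith [mul_le_mul_of_nonneg_left h2 hθ]
  · set B := A.filter fun e => ¬(p₁ e ∨ p₂ e)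
    have hBm : ∀ e ∈ B, (e ∉ S.1 ∧ marginal f S.1 e ≤ θ) ∧ (e ∉ S.2 ∧ marginal f S.2 e ≤ θ) := by
      intro e he
      obtain ⟨heA, hep⟩ := Finset.mem_filter.1 he
      simp only [hp₁, hp₂, not_or, not_not] at hep
      obtain ⟨⟨h1, h1i⟩, h2, h2i⟩ := hep
      obtain ⟨r1, r2⟩ := thresholdSets_rejected hf M l (hAl e heA) hS.symm h1
      refine ⟨⟨h1, ?_⟩, h2, ?_⟩
      · by_contra! h
        exact r1 ⟨h.le, h1i⟩
      · by_contra! h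
        exact r2 h2 ⟨h.le, h2i⟩
    have u1 := hf.union_le (S := S.1) B fun e he => (hBm e he).1
    have u2 := hf.union_le (S := S.2) B fun e he => (hBm e he).2
    -- Disjointness of the two sets makes the intersection exactly B; the union term is dropped by
    -- nonnegativity. The error 2θ|A| is one θ|B| for each set.
    have u3 := hf (S.1 ∪ B) (S.2 ∪ B)
    have u4 : (S.1 ∪ B) ∩ (S.2 ∪ B) = B := by
      rw [← Finset.inter_union_distrib_right, Finset.disjoint_iff_inter_eq_empty.1 hdisj,
        Finset.empty_union]
    rw [u4] at u3
    have u5 := hf (A.filter fun e => p₁ e ∨ p₂ e) B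
    have u6 : (A.filter fun e => p₁ e ∨ p₂ e) ∪ B = A :=
      Finset.filter_union_filter_not_eq _ A
    rw [u6] at u5
    have u7 : (B.card : ℝ) ≤ A.card := by
      exact_mod_cast Finset.card_le_card (Finset.filter_subset _ _)
    have u8 := mul_le_mul_of_nonneg_left u7 hθ
    have u9 := hpos (S.1 ∪ B ∪ (S.2 ∪ B))
    have u10 := hpos ((A.filter fun e => p₁ e ∨ p₂ e) ∩ B)
    rw [htot]
    linarith

/-- The sum over geometrically decreasing thresholds of the values built by the threshold algorithm
pays for every independent set of arriving elements, up to an error that shrinks with the smallest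
threshold. -/
theorem le_sum_totalValue {f : Finset Ω → ℝ} (hf : IsSubmodular f) (hpos : ∀ S, 0 ≤ f S)
    (h0 : f ∅ = 0) (M : Matroid Ω) {W : ℝ} (hW : 0 ≤ W) {l : List Ω} (hl : l.Nodup)
    (hWl : ∀ e ∈ l, f {e} ≤ W) (i : ℕ) {A : Finset Ω} (hA : M.Indep (A : Set Ω))
    (hAl : ∀ e ∈ A, e ∈ l) :
    f A ≤ 2 * (W / 2 ^ i) * A.card +
      5 * ∑ j ∈ Finset.range (i + 1), totalValue f M (W / 2 ^ j) l := by
  induction i generalizing A with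
  | zero =>
    have h1 := hf.le_mul_card h0 A fun e he => hWl e (hAl e he)
    have h2 := totalValue_nonneg hpos M (W / 2 ^ 0) l
    have h3 : 0 ≤ W * A.card := by positivity
    simp only [pow_zero, div_one, zero_add, Finset.range_one, Finset.sum_singleton] at h2 ⊢
    linarith
  | succ i ih =>
    obtain ⟨D, hDA, hD, hAD⟩ := exists_blocked_subset hf hpos h0 M
      (θ := W / 2 ^ (i + 1)) (by positivity) hl hA hAl
    have h1 := ih (hA.subset (Finset.coe_subset.2 hDA)) fun e he => hAl e (hDA he)
    rw [Finset.sum_range_succ]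
    -- With θ the new threshold, the error for D at level i is 4θ|D|, at most four times the total
    -- value at θ. The total value already present in `hAD` makes it five.
    have h2 : W / 2 ^ i = 2 * (W / 2 ^ (i + 1)) := by
      rw [pow_succ]; field_simp
    rw [h2] at h1
    linarith

theorem thresholdSets_nonempty {f : Finset Ω → ℝ} (hf : IsSubmodular f) (h0 : f ∅ = 0)
    (M : Matroid Ω) {θ : ℝ} {l : List Ω} {e : Ω} (he : e ∈ l) (hθ : θ ≤ f {e})
    (hi : M.Indep {e}) : (thresholdSets f (indepOracle M) θ l).1.Nonempty := by
  rw [Finset.nonempty_iff_ne_empty]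
  intro h
  have := (thresholdSets_rejected hf M l (θ := θ) he rfl (by simp [h])).1
  rw [h] at this
  exact this ⟨by simpa [marginal, h0] using hθ, by simpa [indepOracle] using hi⟩

/-! ### The algorithm is online and its output is independent -/

theorem thresholdSets_congr {f g : Finset Ω → ℝ} {Ind Jnd : Finset Ω → Prop} {θ : ℝ} (l : List Ω)
    (h : ∀ S : Finset Ω, S ⊆ l.toFinset → f S = g S ∧ (Ind S ↔ Jnd S)) :
    thresholdSets f Ind θ l = thresholdSets g Jnd θ l := by
  induction l using List.reverseRecOn with
  | nil => rfl
  | append_singleton l e ih =>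
    have hl : l.toFinset ⊆ (l ++ [e]).toFinset := by simp
    rw [thresholdSets_append, thresholdSets_append, ← ih fun S hS => h S (hS.trans hl)]
    have hs := thresholdSets_subset f Ind θ l
    set R := thresholdSets f Ind θ l
    have key : ∀ S ⊆ l.toFinset, marginal f S e = marginal g S e ∧
        (Ind (insert e S) ↔ Jnd (insert e S)) := by
      intro S hS
      have h1 := h (insert e S) (Finset.insert_subset (by simp) (hS.trans hl))
      exact ⟨by unfold marginal; rw [h1.1, (h S (hS.trans hl)).1], h1.2⟩
    classical
    have k1 := key R.1 hs.1
    have k2 := key R.2 hs.2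
    unfold thresholdStep
    exact if_congr (by rw [k1.1, k1.2]) rfl (if_congr (by rw [k2.1, k2.2]) rfl rfl)

theorem secretarySelect_isOnline (n i : ℕ) (b : Bool) :
    IsOnline (secretarySelect (Ω := Ω) n i b) := by
  refine ⟨fun f Ind => ?_, fun f Ind l e => ?_, fun f g Ind Jnd l h => ?_⟩
  · cases b <;> simp [secretarySelect, thresholdSets]
  · unfold secretarySelect
    rcases lt_or_ge l.length (n / 2) with hl | hl
    · left
      rw [List.drop_eq_nil_of_le (as := l ++ [e]) (by simp; omega), List.drop_eq_nil_of_le hl.le]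
      simp [thresholdSets]
    · rw [List.take_append_of_le_length hl, List.drop_append_of_le_length hl]
      dsimp only
      rw [thresholdSets_append]
      rcases thresholdStep_cases f Ind (bestSingle f (l.take (n / 2)) / 2 ^ i)
        (thresholdSets f Ind (bestSingle f (l.take (n / 2)) / 2 ^ i) (l.drop (n / 2))) e with
        ⟨-, -, hc⟩ | ⟨-, -, -, hc⟩ | ⟨-, -, hc⟩ <;> rw [hc] <;> cases b <;> simp
  · unfold secretarySelect
    have h1 : bestSingle f (l.take (n / 2)) = bestSingle g (l.take (n / 2)) :=
      bestSingle_congr fun e he => (h {e} (by simpa using List.mem_of_mem_take he)).1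
    have h2 : ∀ θ, thresholdSets f Ind θ (l.drop (n / 2)) =
        thresholdSets g Jnd θ (l.drop (n / 2)) := fun θ =>
      thresholdSets_congr _ fun S hS => h S fun x hx => by
        have := hS hx
        rw [List.mem_toFinset] at this ⊢
        exact List.mem_of_mem_drop this
    simp only [h1, h2]

theorem secretaryOutput_indep [Fintype Ω] (f : Finset Ω → ℝ) (M : Matroid Ω)
    (σ : Fin (Fintype.card Ω) ≃ Ω) (i : ℕ) (b : Bool) :
    M.Indep (secretaryOutput f M σ i b : Set Ω) := by
  unfold secretaryOutput secretarySelect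
  cases b
  · exact (thresholdSets_indep M _).2
  · exact (thresholdSets_indep M _).1

/-! ### Random arrival orders -/

section Averaging

variable [Fintype Ω]

theorem card_filter_apply_eq (p q : Fin (Fintype.card Ω)) (e : Ω) :
    (Finset.univ.filter fun σ : Fin (Fintype.card Ω) ≃ Ω => σ p = e).card =
      (Finset.univ.filter fun σ : Fin (Fintype.card Ω) ≃ Ω => σ q = e).card := by
  refine Finset.card_bij' (fun σ _ => (Equiv.swap p q).trans σ)
    (fun σ _ => (Equiv.swap p q).trans σ) ?_ ?_ ?_ ?_ <;> intro σ hσ <;>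
    simp only [Finset.mem_filter, Finset.mem_univ, true_and] at hσ ⊢ <;>
    first | simpa using hσ | (ext x; simp)

/-- Each position is equally likely for e: swapping two positions is a bijection between the
corresponding fibres. -/
theorem card_orders_mul (p : Fin (Fintype.card Ω)) (e : Ω) :
    Fintype.card Ω * (Finset.univ.filter fun σ : Fin (Fintype.card Ω) ≃ Ω => σ p = e).card =
      Fintype.card (Fin (Fintype.card Ω) ≃ Ω) := by
  have h := Finset.card_eq_sum_card_fiberwise (s := Finset.univ) (t := Finset.univ)
    (f := fun σ : Fin (Fintype.card Ω) ≃ Ω => σ.symm e) (fun _ _ => Finset.mem_univ _)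
  rw [Finset.card_univ] at h
  rw [h, Finset.sum_congr rfl (g := fun _ =>
    (Finset.univ.filter fun σ : Fin (Fintype.card Ω) ≃ Ω => σ p = e).card)]
  · simp
  · intro q _
    rw [card_filter_apply_eq p q e]
    congr 1
    ext σ
    simp only [Finset.mem_filter, Finset.mem_univ, true_and]
    rw [Equiv.symm_apply_eq, eq_comm]

/-- Composition with `revFixing p` permutes the orders that place e at p, so summing the bound over
all pairs counts each order twice. -/
theorem le_sum_of_pairing {e : Ω} {p : Fin (Fintype.card Ω)} (hp : p.val < Fintype.card Ω / 2)
    {g : Finset Ω → ℝ} {c : ℝ}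
    (hg : ∀ T T' : Finset Ω, (∀ x, x ≠ e → x ∈ T ∨ x ∈ T') → c ≤ g T + g T') :
    c * (Finset.univ.filter fun σ : Fin (Fintype.card Ω) ≃ Ω => σ p = e).card ≤
      2 * ∑ σ ∈ Finset.univ.filter fun σ : Fin (Fintype.card Ω) ≃ Ω => σ p = e,
        g (arriving σ) := by
  set s := Finset.univ.filter fun σ : Fin (Fintype.card Ω) ≃ Ω => σ p = e with hs
  have hfix : (revFixing p).symm p = p := by
    rw [Equiv.symm_apply_eq, revFixing_self]
  have h1 : ∑ σ ∈ s, g (arriving ((revFixing p).symm.trans σ)) = ∑ σ ∈ s, g (arriving σ) := by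
    refine Finset.sum_bij' (fun σ _ => (revFixing p).symm.trans σ)
      (fun σ _ => (revFixing p).trans σ) ?_ ?_ ?_ ?_ ?_
    · intro σ hσ
      simpa [hs, hfix] using hσ
    · intro σ hσ
      simpa [hs, revFixing_self] using hσ
    · intro σ _
      ext x; simp
    · intro σ _
      ext x; simp
    · intro σ _
      rfl
  have h2 : ∑ _σ ∈ s, c ≤
      ∑ σ ∈ s, (g (arriving σ) + g (arriving ((revFixing p).symm.trans σ))) := by
    refine Finset.sum_le_sum fun σ hσ => hg _ _ fun x hx => arriving_revFixing hp ?_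
    rwa [(Finset.mem_filter.1 hσ).2]
  rw [Finset.sum_add_distrib, h1, Finset.sum_const, nsmul_eq_mul] at h2
  linarith

/-- The element e is sampled with probability ⌊n/2⌋/n ≥ 1/3, and given its sampled position the
pairing yields c/2 on average; hence the 6. -/
theorem le_expect_of_pairing (hn : 2 ≤ Fintype.card Ω) (e : Ω) {g : Finset Ω → ℝ} {c : ℝ}
    (hc : 0 ≤ c) (hg : ∀ T T' : Finset Ω, (∀ x, x ≠ e → x ∈ T ∨ x ∈ T') → c ≤ g T + g T')
    {G : (Fin (Fintype.card Ω) ≃ Ω) → ℝ} (hG : ∀ σ, 0 ≤ G σ)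
    (hgG : ∀ σ, (σ.symm e).val < Fintype.card Ω / 2 → g (arriving σ) ≤ G σ) :
    c / 6 ≤ 𝔼 σ, G σ := by
  let p₀ : Fin (Fintype.card Ω) := ⟨0, by omega⟩
  set N := (Finset.univ.filter fun σ : Fin (Fintype.card Ω) ≃ Ω => σ p₀ = e).card with hN
  have hNmul : Fintype.card Ω * N = Fintype.card (Fin (Fintype.card Ω) ≃ Ω) := card_orders_mul p₀ e
  set P : Finset (Fin (Fintype.card Ω)) := Finset.univ.filter fun p => p.val < Fintype.card Ω / 2 with hP
  have hPcard : P.card = Fintype.card Ω / 2 := by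
    rw [hP, Fin.card_filter_val_lt]
    omega
  have h1 : ∀ p ∈ P, c * N / 2 ≤ ∑ σ ∈ Finset.univ.filter fun σ : Fin (Fintype.card Ω) ≃ Ω => σ p = e, G σ := by
    intro p hp
    have hp' : p.val < Fintype.card Ω / 2 := (Finset.mem_filter.1 hp).2
    have h2 := le_sum_of_pairing hp' hg
    have h3 := card_filter_apply_eq p p₀ e
    rw [h3, ← hN] at h2
    have h4 : ∑ σ ∈ Finset.univ.filter fun σ : Fin (Fintype.card Ω) ≃ Ω => σ p = e, g (arriving σ) ≤
        ∑ σ ∈ Finset.univ.filter fun σ : Fin (Fintype.card Ω) ≃ Ω => σ p = e, G σ := by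
      refine Finset.sum_le_sum fun σ hσ => hgG σ ?_
      rw [← (Finset.mem_filter.1 hσ).2]
      simpa using hp'
    linarith
  have h5 : ∑ p ∈ P, ∑ σ ∈ Finset.univ.filter (fun σ : Fin (Fintype.card Ω) ≃ Ω => σ p = e), G σ ≤ ∑ σ, G σ := by
    have h6 : ∑ p, ∑ σ ∈ Finset.univ.filter (fun σ : Fin (Fintype.card Ω) ≃ Ω => σ p = e), G σ = ∑ σ, G σ := by
      rw [← Finset.sum_fiberwise (s := Finset.univ) (g := fun σ : Fin (Fintype.card Ω) ≃ Ω => σ.symm e)]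
      refine Finset.sum_congr rfl fun p _ => Finset.sum_congr ?_ fun _ _ => rfl
      ext σ
      simp only [Finset.mem_filter, Finset.mem_univ, true_and]
      rw [Equiv.symm_apply_eq, eq_comm]
    rw [← h6]
    exact Finset.sum_le_sum_of_subset_of_nonneg (Finset.subset_univ _)
      fun p _ _ => Finset.sum_nonneg fun σ _ => hG σ
  have h7 := Finset.sum_le_sum h1
  rw [Finset.sum_const, hPcard, nsmul_eq_mul] at h7
  have h8 : (Fintype.card Ω : ℝ) ≤ 3 * (Fintype.card Ω / 2 : ℕ) := by
    have : Fintype.card Ω ≤ 3 * (Fintype.card Ω / 2) := by omega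
    exact_mod_cast this
  have h9 : (0 : ℝ) < Fintype.card (Fin (Fintype.card Ω) ≃ Ω) := by
    have : Nonempty (Fin (Fintype.card Ω) ≃ Ω) := ⟨(Fintype.equivFin Ω).symm⟩
    exact_mod_cast Fintype.card_pos
  rw [Fintype.expect_eq_sum_div_card, le_div_iff₀ h9, ← hNmul]
  push_cast
  have h10 : 0 ≤ c * N / 2 := by positivity
  have h11 := mul_le_mul_of_nonneg_right h8 h10
  linarith

end Averaging

/-! ### The approximation guarantee -/

section Guarantee

variable [Fintype Ω]

/-- The value of both sets of the algorithm, summed over all thresholds. -/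
noncomputable def sumValue (f : Finset Ω → ℝ) (M : Matroid Ω) (k : ℕ)
    (σ : Fin (Fintype.card Ω) ≃ Ω) : ℝ :=
  ∑ i ∈ Finset.range (numThresholds k),
    totalValue f M (bestSingle f ((List.ofFn σ).take (Fintype.card Ω / 2)) / 2 ^ i)
      ((List.ofFn σ).drop (Fintype.card Ω / 2))

theorem sumValue_nonneg {f : Finset Ω → ℝ} (hpos : ∀ S, 0 ≤ f S) (M : Matroid Ω) (k : ℕ)
    (σ : Fin (Fintype.card Ω) ≃ Ω) : 0 ≤ sumValue f M k σ :=
  Finset.sum_nonneg fun _ _ => totalValue_nonneg hpos _ _ _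

theorem expectedValue_eq (f : Finset Ω → ℝ) (M : Matroid Ω) (k : ℕ) :
    expectedValue f M k = (𝔼 σ, sumValue f M k σ) / (2 * numThresholds k) := by
  unfold expectedValue
  rw [Finset.expect_div]
  refine Finset.expect_congr rfl fun σ _ => ?_
  rw [Finset.expect_eq_sum_div_card, Finset.card_range, sumValue, ← div_div]
  congr 1
  rw [Finset.sum_div]
  refine Finset.sum_congr rfl fun i _ => ?_
  rw [Fintype.expect_eq_sum_div_card, Fintype.sum_bool, Fintype.card_bool]
  simp only [secretaryOutput, secretarySelect, totalValue, if_true, Bool.false_eq_true, if_false]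
  push_cast
  ring

theorem le_sumValue_of_top_sampled {f : Finset Ω → ℝ} (hf : IsSubmodular f) (hpos : ∀ S, 0 ≤ f S)
    (h0 : f ∅ = 0) (M : Matroid Ω) {k : ℕ} {O : Finset Ω} (hO : M.Indep (O : Set Ω))
    (hk : O.card ≤ k) {e₁ : Ω} (htop : ∀ e, f {e} ≤ f {e₁}) {σ : Fin (Fintype.card Ω) ≃ Ω}
    (hσ : (σ.symm e₁).val < Fintype.card Ω / 2) :
    f (O ∩ arriving σ) ≤ f {e₁} / 4 + 5 * sumValue f M k σ := by
  have hW : bestSingle f ((List.ofFn σ).take (Fintype.card Ω / 2)) = f {e₁} :=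
    le_antisymm (bestSingle_le f (hpos _) fun e _ => htop e) (le_bestSingle f (mem_take_ofFn hσ))
  have h := le_sum_totalValue hf hpos h0 M (hpos {e₁})
    (nodup_drop_ofFn σ (Fintype.card Ω / 2)) (fun e _ => htop e) (2 + Nat.clog 2 (2 * k))
    (A := O ∩ arriving σ) (hO.subset (by simp)) fun e he =>
      mem_drop_ofFn.2 (mem_arriving.1 (Finset.mem_inter.1 he).2)
  have hnum : 2 + Nat.clog 2 (2 * k) + 1 = numThresholds k := by unfold numThresholds; omega
  rw [hnum] at h
  rw [sumValue, hW]
  -- The range of exponents is chosen for this: the smallest threshold θ keeps the error 2θ|O ∩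
  -- arriving| below W/4.
  have h1 : 8 * k ≤ 2 ^ (2 + Nat.clog 2 (2 * k)) := by
    have := Nat.le_pow_clog (b := 2) (by norm_num) (2 * k)
    rw [pow_add]
    omega
  have h2 : 8 * (O ∩ arriving σ).card ≤ 2 ^ (2 + Nat.clog 2 (2 * k)) :=
    (Nat.mul_le_mul_left 8 ((Finset.card_le_card Finset.inter_subset_left).trans hk)).trans h1
  have h3 : 8 * ((O ∩ arriving σ).card : ℝ) ≤ 2 ^ (2 + Nat.clog 2 (2 * k)) := by
    exact_mod_cast h2
  have h4 : 2 * (f {e₁} / 2 ^ (2 + Nat.clog 2 (2 * k))) * (O ∩ arriving σ).card ≤ f {e₁} / 4 := by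
    have hp : (0 : ℝ) < 2 ^ (2 + Nat.clog 2 (2 * k)) := by positivity
    have h5 := mul_le_mul_of_nonneg_left h3 (hpos {e₁})
    rw [mul_div_assoc', div_mul_eq_mul_div, div_le_div_iff₀ hp (by norm_num)]
    linarith
  linarith

theorem sumValue_ge_first {f : Finset Ω → ℝ} (hpos : ∀ S, 0 ≤ f S) (M : Matroid Ω) (k : ℕ)
    (σ : Fin (Fintype.card Ω) ≃ Ω) :
    f (thresholdSets f (indepOracle M) (bestSingle f ((List.ofFn σ).take (Fintype.card Ω / 2)))
      ((List.ofFn σ).drop (Fintype.card Ω / 2))).1 ≤ sumValue f M k σ := by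
  have h := Finset.single_le_sum (s := Finset.range (numThresholds k)) (f := fun i =>
    totalValue f M (bestSingle f ((List.ofFn σ).take (Fintype.card Ω / 2)) / 2 ^ i)
      ((List.ofFn σ).drop (Fintype.card Ω / 2)))
    (fun i _ => totalValue_nonneg hpos _ _ _)
    (show 0 ∈ Finset.range (numThresholds k) by simp [numThresholds])
  refine le_trans ?_ h
  simp only [pow_zero, div_one]
  exact le_add_of_nonneg_right (hpos _)

theorem expect_spread {f : Finset Ω → ℝ} (hf : IsSubmodular f) (hpos : ∀ S, 0 ≤ f S)
    (h0 : f ∅ = 0) (M : Matroid Ω) {k : ℕ} {O : Finset Ω} (hO : M.Indep (O : Set Ω))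
    (hk : O.card ≤ k) {e₁ : Ω} (htop : ∀ e, f {e} ≤ f {e₁}) (hOpt : f {e₁} ≤ f O)
    (hn : 2 ≤ Fintype.card Ω) (h : e₁ ∉ O ∨ 2 * f {e₁} ≤ f O) :
    f O / 120 ≤ 𝔼 σ, sumValue f M k σ := by
  -- Conditioning on e₁ being sampled loses it from O. What remains must cover two errors of
  -- f({e₁})/4, one for each paired order, and leave f(O)/4.
  have hO' : f O / 4 + f {e₁} / 2 ≤ f (O.erase e₁) := by
    by_cases he : e₁ ∈ O
    · have h2 := h.resolve_left (not_not.2 he)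
      have h1 := hf (O.erase e₁) {e₁}
      rw [Finset.union_comm, ← Finset.insert_eq, Finset.insert_erase he] at h1
      have h3 := hpos (O.erase e₁ ∩ {e₁})
      linarith
    · rw [Finset.erase_eq_of_notMem he]
      have := hpos {e₁}
      linarith
  have key := le_expect_of_pairing hn e₁ (g := fun T => (f (O ∩ T) - f {e₁} / 4) / 5)
    (c := f O / 20) (by have := hpos O; positivity) ?_ (sumValue_nonneg hpos M k) ?_
  · linarith
  · intro T T' hT
    have h1 := hf (O ∩ T) (O ∩ T')
    have h2 := hpos (O ∩ T ∩ (O ∩ T'))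
    have h3 : f O / 4 + f {e₁} / 2 ≤ f (O ∩ T ∪ O ∩ T') := by
      rw [← Finset.inter_union_distrib_left]
      by_cases he : e₁ ∈ T ∪ T'
      · have h4 : O ∩ (T ∪ T') = O := by
          refine Finset.inter_eq_left.2 fun x _ => ?_
          by_cases hx : x = e₁
          · rwa [hx]
          · exact Finset.mem_union.2 (hT x hx)
        rw [h4]
        have := hpos {e₁}
        linarith
      · have h4 : O ∩ (T ∪ T') = O.erase e₁ := by
          ext x
          rw [Finset.mem_inter, Finset.mem_erase, and_comm]
          refine and_congr_left fun _ => ⟨fun hx h => he (h ▸ hx), fun hx => ?_⟩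
          exact Finset.mem_union.2 (hT x hx)
        rwa [h4]
    linarith
  · intro σ hσ
    have := le_sumValue_of_top_sampled hf hpos h0 M hO hk htop hσ
    linarith

/-- At exponent 0 the threshold is f({e₂}), and S₁ is nonempty because e₁ passes it against the
empty set. If e₁ is strictly best, any other member of S₁ would tie with e₂, and the tie condition
leaves only e₂, which was sampled; so S₁ = {e₁}. If the top value is shared, any nonempty S₁ is
worth at least the threshold, which equals f({e₁}). -/
theorem le_sumValue_of_runnerUp_sampled {f : Finset Ω → ℝ} (hf : IsSubmodular f)
    (hpos : ∀ S, 0 ≤ f S) (h0 : f ∅ = 0) (hties : NoRunnerUpTie f) (M : Matroid Ω) (k : ℕ)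
    {e₁ e₂ : Ω} (hi : M.Indep {e₁}) (htop : ∀ e, f {e} ≤ f {e₁})
    (hsec : ∀ e, e ≠ e₁ → f {e} ≤ f {e₂}) {σ : Fin (Fintype.card Ω) ≃ Ω}
    (h₁ : Fintype.card Ω / 2 ≤ (σ.symm e₁).val) (h₂ : (σ.symm e₂).val < Fintype.card Ω / 2) :
    f {e₁} ≤ sumValue f M k σ := by
  have hW : bestSingle f ((List.ofFn σ).take (Fintype.card Ω / 2)) = f {e₂} := by
    refine le_antisymm (bestSingle_le f (hpos _) fun e he => hsec e ?_)
      (le_bestSingle f (mem_take_ofFn h₂))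
    rintro rfl
    exact List.disjoint_take_drop (List.nodup_ofFn.2 σ.injective) le_rfl he (mem_drop_ofFn.2 h₁)
  have h := sumValue_ge_first hpos M k σ
  rw [hW] at h
  set l := (List.ofFn σ).drop (Fintype.card Ω / 2)
  set S := (thresholdSets f (indepOracle M) (f {e₂}) l).1 with hS
  have hne : S.Nonempty := thresholdSets_nonempty hf h0 M (mem_drop_ofFn.2 h₁) (htop e₂) hi
  refine le_trans ?_ h
  rcases (htop e₂).lt_or_eq with hlt | heq
  · suffices S = {e₁} by rw [this]
    refine (Finset.Nonempty.subset_singleton_iff hne).1 fun e he => Finset.mem_singleton.2 ?_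
    by_contra hne'
    have h3 : f {e} = f {e₂} := (hsec e hne').antisymm (thresholdSets_single_ge hf h0 l e he)
    have h4 : e ∈ l := List.mem_toFinset.1 ((thresholdSets_subset f _ _ l).1 he)
    rw [hties e₁ e₂ e hlt hsec h3] at h4
    exact absurd (mem_drop_ofFn.1 h4) (not_le.2 h₂)
  · have h3 : f {e₂} * S.card ≤ f S := (thresholdSets_card_le h0 l).1
    have h4 : (1 : ℝ) ≤ S.card := by exact_mod_cast hne.card_pos
    rw [heq] at h3
    nlinarith [hpos {e₁}]

theorem expect_single {f : Finset Ω → ℝ} (hf : IsSubmodular f) (hpos : ∀ S, 0 ≤ f S)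
    (h0 : f ∅ = 0) (hties : NoRunnerUpTie f) (M : Matroid Ω) (k : ℕ) {e₁ : Ω} (hi : M.Indep {e₁})
    (htop : ∀ e, f {e} ≤ f {e₁}) : f {e₁} / 6 ≤ 𝔼 σ, sumValue f M k σ := by
  rcases (Finset.univ.erase e₁).eq_empty_or_nonempty with hemp | hne
  · have huniv : ∀ e, e = e₁ := fun e => by
      by_contra he
      have : e ∈ Finset.univ.erase e₁ := by simp [he]
      simp [hemp] at this
    have hcard : Fintype.card Ω = 1 := Fintype.card_eq_one_iff.2 ⟨e₁, huniv⟩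
    -- With one element the sample is empty, so W = 0 and e₁ is accepted in every order.
    have hle : ∀ σ, f {e₁} ≤ sumValue f M k σ := by
      intro σ
      refine le_trans ?_ (sumValue_ge_first hpos M k σ)
      have hS := thresholdSets_nonempty hf h0 M
        (θ := bestSingle f ((List.ofFn σ).take (Fintype.card Ω / 2)))
        (l := (List.ofFn σ).drop (Fintype.card Ω / 2)) (e := e₁)
        (mem_drop_ofFn.2 (by simp [hcard])) (bestSingle_le f (hpos _) fun e _ => htop e) hi
      rw [(Finset.Nonempty.subset_singleton_iff (a := e₁) hS).1 fun e _ => by simp [huniv e]]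
    have hne : (Finset.univ : Finset (Fin (Fintype.card Ω) ≃ Ω)).Nonempty :=
      ⟨(Fintype.equivFin Ω).symm, Finset.mem_univ _⟩
    have := Finset.le_expect hne (f := sumValue f M k) (a := f {e₁}) fun σ _ => hle σ
    have := hpos {e₁}
    linarith
  · obtain ⟨e₂, he₂, hsec⟩ := Finset.exists_max_image _ (fun e => f {e}) hne
    have hsec' : ∀ e, e ≠ e₁ → f {e} ≤ f {e₂} := fun e he => hsec e (by simp [he])
    have hn : 2 ≤ Fintype.card Ω :=
      Fintype.one_lt_card_iff.2 ⟨e₂, e₁, Finset.ne_of_mem_erase he₂⟩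
    -- The sampled element is now the runner-up, and e₁ arrives late in one of each two paired
    -- orders.
    refine le_expect_of_pairing hn e₂ (g := fun T => if e₁ ∈ T then f {e₁} else 0) (hpos _) ?_
      (sumValue_nonneg hpos M k) ?_
    · intro T T' hT
      have := hpos {e₁}
      rcases hT e₁ (Finset.ne_of_mem_erase he₂).symm with h | h
      · rw [if_pos h]
        split_ifs <;> linarith
      · rw [if_pos h]
        split_ifs <;> linarith
    · intro σ hσ
      split_ifs with h
      · exact le_sumValue_of_runnerUp_sampled hf hpos h0 hties M k hi htop hsec'
          (mem_arriving.1 h) hσ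
      · exact sumValue_nonneg hpos M k σ

theorem numThresholds_le (k : ℕ) : (numThresholds k : ℝ) ≤ 5 * (1 + Real.log k) := by
  rcases Nat.eq_zero_or_pos k with rfl | hk
  · norm_num [numThresholds]
  · have h1 : Nat.clog 2 (2 * k) ≤ Nat.log 2 k + 2 := by
      rw [Nat.clog_le_iff_le_pow (by norm_num)]
      have := Nat.lt_pow_succ_log_self (b := 2) (by norm_num) k
      rw [pow_succ] at this ⊢
      omega
    have h2 : (2 : ℝ) ^ Nat.log 2 k ≤ k := by
      exact_mod_cast Nat.pow_log_le_self 2 hk.ne'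
    have h3 := Real.log_le_log (by positivity) h2
    rw [Real.log_pow] at h3
    have h4 := Real.log_two_gt_d9
    have h5 : (numThresholds k : ℝ) ≤ 5 + Nat.log 2 k := by
      have : numThresholds k ≤ 5 + Nat.log 2 k := by unfold numThresholds; omega
      exact_mod_cast this
    have h6 : (0 : ℝ) ≤ Nat.log 2 k := by positivity
    nlinarith

/-- The constant is 1200 = 120 · 2 · 5: 120 from the spread case, 2 from the coin, 5 from
`numThresholds_le`. -/
theorem le_expectedValue {f : Finset Ω → ℝ} (hf : IsSubmodular f) (hpos : ∀ S, 0 ≤ f S)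
    (h0 : f ∅ = 0) (hties : NoRunnerUpTie f) {M : Matroid Ω} {k : ℕ} (hk : M.eRank = (k : ℕ∞))
    (hle : ∀ e : Ω, ∃ I : Finset Ω, M.Indep (I : Set Ω) ∧ f {e} ≤ f I) {O : Finset Ω}
    (hO : M.Indep (O : Set Ω)) (hmax : ∀ I : Finset Ω, M.Indep (I : Set Ω) → f I ≤ f O) :
    f O ≤ 1200 * (1 + Real.log k) * expectedValue f M k := by
  have hcard : O.card ≤ k := by
    have := hO.encard_le_eRank
    rw [hk, Set.encard_coe_eq_coe_finsetCard] at this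
    exact_mod_cast this
  have hmain : f O / 120 ≤ 𝔼 σ, sumValue f M k σ := by
    rcases O.eq_empty_or_nonempty with rfl | ⟨e₀, he₀⟩
    · rw [h0, zero_div]
      exact Finset.expect_nonneg fun σ _ => sumValue_nonneg hpos M k σ
    · obtain ⟨e₁, -, htop'⟩ := Finset.exists_max_image Finset.univ (fun e => f {e})
        ⟨e₀, Finset.mem_univ _⟩
      -- The element e₁ may be a loop; it then lies outside O and serves only to calibrate W, for
      -- which f({e₁}) ≤ f(O) suffices.
      have htop : ∀ e, f {e} ≤ f {e₁} := fun e => htop' e (Finset.mem_univ e)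
      have hOpt : f {e₁} ≤ f O := by
        obtain ⟨I, hI, h⟩ := hle e₁
        exact h.trans (hmax I hI)
      by_cases he : e₁ ∈ O ∧ f O < 2 * f {e₁}
      · have := expect_single hf hpos h0 hties M k
          (hO.subset (Set.singleton_subset_iff.2 (Finset.mem_coe.2 he.1))) htop
        have := he.2
        have := hpos O
        linarith
      · rw [not_and_or, not_lt] at he
        rcases le_or_gt 2 (Fintype.card Ω) with hn | hn
        · exact expect_spread hf hpos h0 M hO hcard htop hOpt hn he
        · have hsub : Subsingleton Ω := Fintype.card_le_one_iff_subsingleton.1 (by omega)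
          have h1 : O = {e₁} := by
            ext x
            simp [Subsingleton.elim x e₀, Subsingleton.elim e₁ e₀, he₀]
          have h2 := expect_single hf hpos h0 hties M k (e₁ := e₁)
            (by simpa [h1] using hO) htop
          have := hpos {e₁}
          rw [h1]
          linarith
  have hN := numThresholds_le k
  have hN0 : (0 : ℝ) < numThresholds k := by unfold numThresholds; positivity
  have hE : (𝔼 σ, sumValue f M k σ) = 2 * numThresholds k * expectedValue f M k := by
    rw [expectedValue_eq]
    field_simp
  have hE0 : 0 ≤ expectedValue f M k := by
    rw [expectedValue_eq]
    exact div_nonneg (Finset.expect_nonneg fun σ _ => sumValue_nonneg hpos M k σ) (by positivity)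
  have := mul_le_mul_of_nonneg_right hN hE0
  rw [hE] at hmain
  linarith

end Guarantee

end SubmodularSecretary

theorem mainTheorem10 :
    ∃ C : ℝ, 0 < C ∧
      ∀ (Ω : Type*) [Fintype Ω] [DecidableEq Ω] (M : Matroid Ω) (k : ℕ) (f : Finset Ω → ℝ),
        M.E = Set.univ → M.eRank = (k : ℕ∞) →
        SubmodularSecretary.IsSubmodular f → (∀ S, 0 ≤ f S) → f ∅ = 0 →
        (∀ e : Ω, ∃ I : Finset Ω, M.Indep (I : Set Ω) ∧ f {e} ≤ f I) →
        SubmodularSecretary.NoRunnerUpTie f →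
        (∀ (i : ℕ) (b : Bool), SubmodularSecretary.IsOnline
          (SubmodularSecretary.secretarySelect (Ω := Ω) (Fintype.card Ω) i b)) ∧
        (∀ (σ : Fin (Fintype.card Ω) ≃ Ω) (i : ℕ) (b : Bool),
          M.Indep (SubmodularSecretary.secretaryOutput f M σ i b : Set Ω)) ∧
        ∀ Cstar : Finset Ω, M.Indep (Cstar : Set Ω) →
          f Cstar ≤ C * (1 + Real.log k) * SubmodularSecretary.expectedValue f M k := by
  refine ⟨1200, by norm_num, ?_⟩
  intro Ω _ _ M k f _ hk hf hpos h0 hle hties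
  refine ⟨fun i b => SubmodularSecretary.secretarySelect_isOnline _ i b,
    fun σ i b => SubmodularSecretary.secretaryOutput_indep f M σ i b, fun Cstar hC => ?_⟩
  classical
  obtain ⟨O, hO, hmax⟩ := Finset.exists_max_image
    (Finset.univ.filter fun I : Finset Ω => M.Indep (I : Set Ω)) f ⟨Cstar, by simp [hC]⟩
  simp only [Finset.mem_filter, Finset.mem_univ, true_and] at hO hmax
  exact (hmax Cstar hC).trans
    (SubmodularSecretary.le_expectedValue hf hpos h0 hties hk hle hO hmax)
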